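/- For a metric space $X$, a topological space $Y$ and $\varepsilon>0$, a continuous map $f:X\to Y$ is called an $\varepsilon$-embedding if $\operatorname{diam} f^{-1}(y)\le\varepsilon$ for every $y\in Y$. For a compact metric space $(X,d)$, let $\mathrm{Widim}_\varepsilon(X,d)$ be the minimum integer $k$ such that there exist a $k$-dimensional polyhedron $P$ (the underlying space of a locally finite $k$-dimensional simplicial complex in some $\mathbb{R}^N$) and an $\varepsilon$-embedding $f:X\to P$. For real $p\ge 1$ and an integer $n\ge 1$, let $$B_{\ell^p}(\mathbb{R}^n)=\Big\{x\in\mathbb{R}^n : \sum_{k=1}^n|x_k|^p\le 1\Big\},\qquad d_{\ell^\infty}(x,y)=\max_{1\le k\le n}|x_k-y_k| .$$ Then for every real $p$ with $1\le p<\infty$, every integer $n\ge 1$ and every real $\varepsilon>0$, $$\mathrm{Widim}_\varepsilon\big(B_{\ell^p}(\mathbb{R}^n),d_{\ell^\infty}\big)=\min\big(n,\ \lceil(2/\varepsilon)^p\rceil-1\big),$$ where $\lceil t\rceil$ denotes the smallest integer $\ge t$. -/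

import Mathlib

open Topology

/-- A continuous map `f : X → Y` on a metric space is an `ε`-embedding if all its fibres have
diameter at most `ε`. (The diameter is the extended one, so there is no junk value.) -/
structure IsEpsEmbedding {X Y : Type*} [MetricSpace X] [TopologicalSpace Y]
    (ε : ℝ) (f : X → Y) : Prop where
  continuous : Continuous f
  ediam_fiber_le : ∀ y : Y, Metric.ediam (f ⁻¹' {y}) ≤ ENNReal.ofReal ε

/-- A simplicial complex in a Euclidean space is locally finite if every point of its underlying
space has a neighbourhood that meets only finitely many of its (closed) simplices. The subspace
topology on the underlying space is then the usual topology of the complex. -/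
def IsLocallyFiniteComplex {N : ℕ}
    (K : Geometry.SimplicialComplex ℝ (EuclideanSpace ℝ (Fin N))) : Prop :=
  ∀ x ∈ K.space, ∃ U ∈ 𝓝 x,
    {s ∈ K.faces | (convexHull ℝ (s : Set (EuclideanSpace ℝ (Fin N))) ∩ U).Nonempty}.Finite

/-- The simplicial complex `K` has dimension exactly `k`: it has a `k`-simplex, and no simplex of
larger dimension. -/
def HasComplexDim {N : ℕ} (K : Geometry.SimplicialComplex ℝ (EuclideanSpace ℝ (Fin N)))
    (k : ℕ) : Prop :=
  (∃ s ∈ K.faces, s.card = k + 1) ∧ ∀ s ∈ K.faces, s.card ≤ k + 1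

/-- `P` is a `k`-dimensional polyhedron in `ℝ^N`: the underlying space of a locally finite
`k`-dimensional simplicial complex (in particular, every finite complex is allowed). -/
def IsPolyhedron {N : ℕ} (k : ℕ) (P : Set (EuclideanSpace ℝ (Fin N))) : Prop :=
  ∃ K : Geometry.SimplicialComplex ℝ (EuclideanSpace ℝ (Fin N)),
    IsLocallyFiniteComplex K ∧ HasComplexDim K k ∧ K.space = P

/-- The set of all `k` such that `X` admits an `ε`-embedding into some `k`-dimensional
polyhedron. -/
def widimSet (X : Type*) [MetricSpace X] (ε : ℝ) : Set ℕ :=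
  {k | ∃ (N : ℕ) (P : Set (EuclideanSpace ℝ (Fin N))) (f : X → P),
    IsPolyhedron k P ∧ IsEpsEmbedding ε f}

/-- The width dimension `Widim_ε X` of a (compact) metric space `X`: the least dimension of a
polyhedron into which `X` admits an `ε`-embedding, and `⊤` if there is none. -/
noncomputable def widim (X : Type*) [MetricSpace X] (ε : ℝ) : ℕ∞ :=
  ⨅ k ∈ widimSet X ε, (k : ℕ∞)

/-- The closed unit ball of `ℓ^p` in `ℝ^n`. As a subset of `Fin n → ℝ` it carries the
`ℓ^∞`-distance `max_k |x_k - y_k|`, which is Mathlib's distance on `Fin n → ℝ`. -/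
def lpBall (p : ℝ) (n : ℕ) : Set (Fin n → ℝ) :=
  {x | ∑ k, |x k| ^ p ≤ 1}

/-! Upper bound: shrink every coordinate towards 0 by `τ = ε / 2`. Equal images force each pair of
coordinates to agree or to lie in `[-τ, τ]`, so fibres have diameter at most `ε`. If `m > 0`
coordinates of a point of the ball exceed `τ` in absolute value, then `m * τ ^ p < 1`; hence the
image lies in a skeleton of the required dimension of a simplex (`softThreshold`,
`mem_widimSet_of_stdSimplex`).

Lower bound: for `j ≤ n` and `0 < j < (2 / ε) ^ p` the ball contains a `j`-cube of side greater than
`ε`, and an `ε`-embedding into `P` cannot identify points of opposite faces. Differences of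
distances to the images of opposite faces form a Lipschitz map `G` on the ambient space of `P`. By
`poincare_miranda`, `G '' P` contains a ball of `ℝ^j`, so `j ≤ dimH P ≤ k`
(`IsPolyhedron.card_le_of_separates_faces`).

Poincaré–Miranda rests on `not_lipschitz_retraction`. The integral of `det (1 + t • Du)` over the
cube is polynomial in `t` and, for small `t > 0`, equals the volume because `id + t • u` permutes
the cube. So it is the volume at `t = 1` too, whereas a retraction onto the boundary has Jacobian 0
almost everywhere. -/

/-! ### Jacobian integrals and the absence of Lipschitz retractions -/

open Polynomial in
/-- The determinant of `1 + A` is a fixed affine combination of determinants of `1 + t • A` with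
`t` small: interpolate the polynomial `t ↦ det (1 + t • A)`. -/
theorem exists_det_one_add_eq_sum (ι : Type*) [Fintype ι] {δ : ℝ} (hδ : 0 < δ) :
    ∃ (T : Finset ℝ) (c : ℝ → ℝ), (∀ t ∈ T, 0 < t ∧ t ≤ δ) ∧ ∑ t ∈ T, c t = 1 ∧
      ∀ A : (ι → ℝ) →L[ℝ] (ι → ℝ), (1 + A).det = ∑ t ∈ T, c t * (1 + t • A).det := by
  classical
  obtain ⟨T, hT, hcard⟩ :=
    (Set.Ioc_infinite hδ).exists_subset_card_eq (Fintype.card ι + 1)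
  have hne : T.Nonempty := Finset.card_pos.1 (by omega)
  refine ⟨T, fun t => (Lagrange.basis T id t).eval 1, fun t ht => hT ht, ?_, fun A => ?_⟩
  · rw [← Polynomial.eval_finsetSum, Lagrange.sum_basis Function.injective_id.injOn hne]
    simp
  · set M := LinearMap.toMatrix' (A : (ι → ℝ) →ₗ[ℝ] (ι → ℝ)) with hM
    set q : ℝ[X] := ((X : ℝ[X]) • M.map C + (1 : Matrix ι ι ℝ).map C).det with hq
    have hdet : ∀ t : ℝ, (1 + t • A).det = q.eval t := by
      intro t
      have h1 : (1 + t • A).det = (1 + t • M).det := by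
        rw [ContinuousLinearMap.det, ← LinearMap.det_toMatrix']
        congr 1
        ext i j
        simp [hM, LinearMap.toMatrix'_apply, Matrix.one_apply, Pi.single_apply]
      rw [h1, hq, ← Polynomial.coe_evalRingHom, RingHom.map_det]
      congr 1
      ext i j
      simp [Matrix.one_apply, apply_ite, add_comm]
      ring
    -- The determinant has degree at most `card ι` in `t`, so `card ι + 1` nodes determine it; the
    -- weights are the Lagrange basis polynomials evaluated at 1.
    have hdeg : q.degree < T.card := by
      refine lt_of_le_of_lt Polynomial.degree_le_natDegree ?_
      rw [hcard]
      exact_mod_cast Nat.lt_succ_of_le (natDegree_det_X_add_C_le M 1)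
    have h1 := hdet 1
    rw [one_smul] at h1
    rw [h1]
    conv_lhs => rw [Lagrange.eq_interpolate Function.injective_id.injOn hdeg,
      Lagrange.interpolate_apply, Polynomial.eval_finsetSum]
    refine Finset.sum_congr rfl fun t ht => ?_
    rw [hdet t]
    simp [mul_comm]

open MeasureTheory Metric Set
open scoped NNReal

/-- A perturbation of the identity by a map with Lipschitz constant less than `1` is bijective. -/
theorem bijective_id_add_of_lipschitzWith {E : Type*} [NormedAddCommGroup E] [NormedSpace ℝ E]
    [CompleteSpace E] {v : E → E} {K : ℝ≥0} (hv : LipschitzWith K v) (hK : K < 1) :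
    Function.Bijective fun x => x + v x := by
  have happ : ApproximatesLinearOn (fun x => x + v x)
      ((ContinuousLinearEquiv.refl ℝ E : E ≃L[ℝ] E) : E →L[ℝ] E) univ K := by
    intro x _ y _
    have := hv.dist_le_mul x y
    rw [dist_eq_norm, dist_eq_norm] at this
    simpa [add_sub_add_comm] using this
  have hc : Subsingleton E ∨
      K < ‖((ContinuousLinearEquiv.refl ℝ E).symm : E →L[ℝ] E)‖₊⁻¹ := by
    rcases subsingleton_or_nontrivial E with h | h
    · exact Or.inl h
    · right
      have : ‖((ContinuousLinearEquiv.refl ℝ E).symm : E →L[ℝ] E)‖₊ = 1 := by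
        ext
        simp
      rw [this]
      simp [hK]
  exact ⟨injOn_univ.1 (happ.injOn hc), happ.surjective hc⟩

/-- The map is the identity off the ball, so it maps the complement onto itself; bijectivity
transfers this to the ball. -/
theorem image_ball_id_add {E : Type*} [NormedAddCommGroup E] {v : E → E} {R : ℝ}
    (hbij : Function.Bijective fun x => x + v x) (h0 : ∀ x, x ∉ ball (0 : E) R → v x = 0) :
    (fun x => x + v x) '' ball 0 R = ball 0 R := by
  have hcompl : (fun x => x + v x) '' (ball 0 R)ᶜ = (ball 0 R)ᶜ := by
    ext y
    constructor
    · rintro ⟨x, hx, rfl⟩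
      simpa [h0 x hx] using hx
    · intro hy
      exact ⟨y, hy, by simp [h0 y hy]⟩
  rw [image_compl_eq hbij] at hcompl
  exact compl_injective hcompl

/-- For the sup norm, Lebesgue measure is the Hausdorff measure of dimension `card ι`, which a
Lipschitz map enlarges by at most a constant factor. -/
theorem LipschitzWith.volume_image_null {ι : Type*} [Fintype ι] {f : (ι → ℝ) → (ι → ℝ)} {K : ℝ≥0}
    (hf : LipschitzWith K f) {s : Set (ι → ℝ)} (hs : volume s = 0) : volume (f '' s) = 0 := by
  rw [← hausdorffMeasure_pi_real] at hs ⊢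
  have := hf.hausdorffMeasure_image_le (Nat.cast_nonneg (Fintype.card ι)) s
  rw [hs, mul_zero] at this
  exact le_antisymm this zero_le

/-- Change of variables for the bijection `id + v` of the ball: the part of the ball outside `s` has
null image, and the sign condition removes the absolute value of the Jacobian. -/
theorem integral_det_id_add_of_lipschitzWith_lt_one {ι : Type*} [Fintype ι]
    {v : (ι → ℝ) → (ι → ℝ)} {K : ℝ≥0} (hv : LipschitzWith K v) (hK : K < 1) {R : ℝ}
    (h0 : ∀ x, x ∉ ball (0 : ι → ℝ) R → v x = 0) {s : Set (ι → ℝ)} (hs : MeasurableSet s)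
    (hsR : s ⊆ ball 0 R) (hnull : volume (ball 0 R \ s) = 0)
    (hdiff : ∀ x ∈ s, DifferentiableAt ℝ v x) (hpos : ∀ x ∈ s, 0 ≤ (1 + fderiv ℝ v x).det) :
    IntegrableOn (fun x => (1 + fderiv ℝ v x).det) s ∧
      ∫ x in s, (1 + fderiv ℝ v x).det = volume.real (ball (0 : ι → ℝ) R) := by
  have hbij := bijective_id_add_of_lipschitzWith hv hK
  have himg := image_ball_id_add hbij h0
  have hder : ∀ x ∈ s, HasFDerivWithinAt (fun x => x + v x) (1 + fderiv ℝ v x) s x := fun x hx =>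
    ((hasFDerivAt_id x).add (hdiff x hx).hasFDerivAt).hasFDerivWithinAt
  have hinj : InjOn (fun x => x + v x) s := hbij.injective.injOn
  have hlip : LipschitzWith (1 + K) fun x => x + v x := LipschitzWith.id.add hv
  have hsub : (fun x => x + v x) '' s ⊆ ball 0 R := himg ▸ image_mono hsR
  have hvol : volume ((fun x => x + v x) '' s) = volume (ball (0 : ι → ℝ) R) := by
    refine le_antisymm (measure_mono hsub) ?_
    conv_lhs => rw [← himg, ← union_sdiff_cancel hsR, image_union]
    refine (measure_union_le _ _).trans ?_
    rw [hlip.volume_image_null hnull, add_zero]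
  have habs : EqOn (fun x => |(1 + fderiv ℝ v x).det| • (1 : ℝ))
      (fun x => (1 + fderiv ℝ v x).det) s := fun x hx => by
    simp [abs_of_nonneg (hpos x hx)]
  constructor
  · refine IntegrableOn.congr_fun ?_ habs hs
    refine (integrableOn_image_iff_integrableOn_abs_det_fderiv_smul volume hs hder hinj
      (fun _ => (1 : ℝ))).1 ?_
    exact integrableOn_const (hvol ▸ measure_ball_lt_top.ne)
  · rw [← setIntegral_congr_fun hs habs,
      ← integral_image_eq_integral_abs_det_fderiv_smul volume hs hder hinj (fun _ => (1 : ℝ))]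
    simp [Measure.real, hvol]

/-- If `u` is Lipschitz and vanishes outside a ball, then the integral of the Jacobian determinant
of `id + u` over the ball is the volume of the ball. -/
theorem integral_det_one_add_fderiv {ι : Type*} [Fintype ι]
    {u : (ι → ℝ) → (ι → ℝ)} {K : ℝ≥0} (hu : LipschitzWith K u) {R : ℝ}
    (h0 : ∀ x, x ∉ ball (0 : ι → ℝ) R → u x = 0) :
    ∫ x in ball (0 : ι → ℝ) R ∩ {x | DifferentiableAt ℝ u x}, (1 + fderiv ℝ u x).det =
      volume.real (ball (0 : ι → ℝ) R) := by
  set s : Set (ι → ℝ) := ball (0 : ι → ℝ) R ∩ {x | DifferentiableAt ℝ u x} with hsdef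
  have hs : MeasurableSet s := measurableSet_ball.inter (measurableSet_of_differentiableAt ℝ u)
  have hnull : volume (ball 0 R \ s) = 0 := by
    refine measure_mono_null (t := {x | ¬ DifferentiableAt ℝ u x}) ?_ hu.ae_differentiableAt
    intro x hx hx'
    exact hx.2 ⟨hx.1, hx'⟩
  have hcont : ∀ᶠ B in 𝓝 (0 : (ι → ℝ) →L[ℝ] (ι → ℝ)), 0 < (1 + B).det := by
    have h1 : ContinuousAt (fun B : (ι → ℝ) →L[ℝ] (ι → ℝ) => (1 + B).det) 0 :=
      (ContinuousLinearMap.continuous_det.comp (continuous_const.add continuous_id)).continuousAt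
    refine h1.eventually (lt_mem_nhds ?_)
    simp [ContinuousLinearMap.det]
  obtain ⟨η, hη, hball⟩ := Metric.eventually_nhds_iff.1 hcont
  -- The first bound makes `t • u` a contraction for `t ≤ δ`; the second keeps `1 + t • fderiv ℝ u
  -- x` where the determinant is positive.
  obtain ⟨δ, hδ, hδ1, hδη⟩ : ∃ δ > (0 : ℝ), δ * K < 1 ∧ δ * K < η := by
    have hK : (0 : ℝ) < K + 1 := by positivity
    have hm : 0 < min 1 η := lt_min one_pos hη
    refine ⟨min 1 η / (K + 1), by positivity, ?_⟩
    have : min 1 η / (K + 1) * K < min 1 η := by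
      rw [div_mul_eq_mul_div, div_lt_iff₀ hK]
      nlinarith [K.2]
    exact ⟨this.trans_le (min_le_left _ _), this.trans_le (min_le_right _ _)⟩
  obtain ⟨T, c, hT, hc, hdet⟩ := exists_det_one_add_eq_sum ι hδ
  have key : ∀ t ∈ T, IntegrableOn (fun x => (1 + t • fderiv ℝ u x).det) s ∧
      ∫ x in s, (1 + t • fderiv ℝ u x).det = volume.real (ball (0 : ι → ℝ) R) := by
    intro t ht
    obtain ⟨ht0, htδ⟩ := hT t ht
    have htK : t * K ≤ δ * K := by gcongr
    have hfd : ∀ x ∈ s, fderiv ℝ (t • u) x = t • fderiv ℝ u x := fun x hx =>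
      fderiv_const_smul hx.2 t
    have hlip : LipschitzWith (‖t‖₊ * K) (t • u) := (lipschitzWith_smul t).comp hu
    have hlt : ‖t‖₊ * K < 1 := by
      rw [← NNReal.coe_lt_coe]
      simpa [abs_of_pos ht0] using htK.trans_lt hδ1
    have hmain := integral_det_id_add_of_lipschitzWith_lt_one hlip hlt (R := R)
      (fun x hx => by simp [h0 x hx]) hs inter_subset_left hnull
      (fun x hx => hx.2.const_smul t) (fun x hx => by
        refine (hball ?_).le
        rw [dist_zero_right, hfd x hx, norm_smul, Real.norm_of_nonneg ht0.le]
        calc t * ‖fderiv ℝ u x‖ ≤ t * K := by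
              gcongr
              exact norm_fderiv_le_of_lipschitz ℝ hu
          _ < η := htK.trans_lt hδη)
    have hcongr : EqOn (fun x => (1 + fderiv ℝ (t • u) x).det)
        (fun x => (1 + t • fderiv ℝ u x).det) s := fun x hx => by
      simp only [hfd x hx]
    exact ⟨hmain.1.congr_fun hcongr hs, by rw [← setIntegral_congr_fun hs hcongr, hmain.2]⟩
  rw [setIntegral_congr_fun hs fun x _ => hdet (fderiv ℝ u x)]
  rw [integral_finsetSum _ fun t ht => (key t ht).1.const_mul _]
  simp_rw [integral_const_mul]
  rw [Finset.sum_congr rfl fun t ht => by rw [(key t ht).2], ← Finset.sum_mul, hc, one_mul]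

/-- There is no Lipschitz retraction of a cube onto its boundary. -/
theorem not_lipschitz_retraction {ι : Type*} [Fintype ι] [Nonempty ι]
    {u : (ι → ℝ) → (ι → ℝ)} {K : ℝ≥0} (hu : LipschitzWith K u) {R : ℝ} (hR : 0 < R)
    (h0 : ∀ x, x ∉ ball (0 : ι → ℝ) R → u x = 0) : ∃ x ∈ ball (0 : ι → ℝ) R, ‖x + u x‖ ≠ R := by
  classical
  by_contra! h
  -- If the values all have sup norm `R`, a coordinate attaining the norm at `x` has a local
  -- extremum there, so one row of the derivative vanishes.
  have hzero : ∀ x ∈ ball (0 : ι → ℝ) R ∩ {x | DifferentiableAt ℝ u x},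
      (1 + fderiv ℝ u x).det = 0 := by
    rintro x ⟨hx, hd⟩
    have hder : HasFDerivAt (fun x => x + u x) (1 + fderiv ℝ u x) x :=
      (hasFDerivAt_id x).add (hd : DifferentiableAt ℝ u x).hasFDerivAt
    obtain ⟨i, hi⟩ : ∃ i, ‖x + u x‖ = |(x + u x) i| := by
      obtain ⟨i, -, hi⟩ := Finset.exists_mem_eq_sup Finset.univ Finset.univ_nonempty
        fun i => ‖(x + u x) i‖₊
      exact ⟨i, by rw [Pi.norm_def, hi]; simp⟩
    have hderi : HasFDerivAt (fun x => (x + u x) i)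
        ((ContinuousLinearMap.proj i).comp (1 + fderiv ℝ u x)) x :=
      (ContinuousLinearMap.proj (R := ℝ) (φ := fun _ : ι => ℝ) i).hasFDerivAt.comp x hder
    have hle : ∀ᶠ y in 𝓝 x, |(y + u y) i| ≤ |(x + u x) i| := by
      filter_upwards [isOpen_ball.mem_nhds hx] with y hy
      rw [← hi, h x hx, ← h y hy, ← Real.norm_eq_abs]
      exact norm_le_pi_norm (y + u y) i
    have hext : IsLocalExtr (fun x => (x + u x) i) x := by
      rcases le_total 0 ((x + u x) i) with hs | hs
      · right
        filter_upwards [hle] with y hy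
        rw [abs_of_nonneg hs] at hy
        exact (le_abs_self _).trans hy
      · left
        filter_upwards [hle] with y hy
        rw [abs_of_nonpos hs] at hy
        exact neg_le_neg_iff.1 ((neg_le_abs _).trans hy)
    have hcomp := hext.hasFDerivAt_eq_zero hderi
    by_contra hne
    have hsurj := (LinearMap.equivOfDetNeZero _ hne).surjective (Pi.single i 1)
    obtain ⟨y, hy⟩ := hsurj
    have h1 := congrFun hy i
    have h2 := DFunLike.congr_fun hcomp y
    simp only [Pi.single_eq_same] at h1
    rw [show (0 : (ι → ℝ) →L[ℝ] ℝ) y = 0 from rfl] at h2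
    exact one_ne_zero (h1.symm.trans h2)
  have hint := integral_det_one_add_fderiv hu h0
  rw [setIntegral_congr_fun (g := fun _ => 0)
    (measurableSet_ball.inter (measurableSet_of_differentiableAt ℝ u)) hzero] at hint
  rw [integral_zero] at hint
  exact (ENNReal.toReal_pos (measure_ball_pos volume (0 : ι → ℝ) hR).ne'
    measure_ball_lt_top.ne).ne hint

/-! ### From the retraction theorem to Poincaré–Miranda -/

theorem LipschitzOnWith.exists_smul_of_isCompact {α E : Type*} [PseudoMetricSpace α]
    [NormedAddCommGroup E] [NormedSpace ℝ E] {S : Set α} (hS : IsCompact S) {φ : α → ℝ} {g : α → E}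
    (hφ : ∃ K, LipschitzOnWith K φ S) (hg : ∃ K, LipschitzOnWith K g S) :
    ∃ K, LipschitzOnWith K (fun x => φ x • g x) S := by
  obtain ⟨K, hφ⟩ := hφ
  obtain ⟨L, hg⟩ := hg
  obtain ⟨A, hA⟩ := hS.exists_bound_of_continuousOn hφ.continuousOn
  obtain ⟨B, hB⟩ := hS.exists_bound_of_continuousOn hg.continuousOn
  refine ⟨(|A| * L + K * |B|).toNNReal, LipschitzOnWith.of_dist_le_mul fun x hx y hy => ?_⟩
  have h1 := hφ.dist_le_mul x hx y hy
  have h2 := hg.dist_le_mul x hx y hy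
  have h3 := (hA x hx).trans (le_abs_self A)
  have h4 := (hB y hy).trans (le_abs_self B)
  rw [Real.coe_toNNReal _ (by positivity)]
  rw [dist_eq_norm] at h1 h2 ⊢
  calc ‖φ x • g x - φ y • g y‖ = ‖φ x • (g x - g y) + (φ x - φ y) • g y‖ := by
        congr 1
        rw [smul_sub, sub_smul]
        abel
    _ ≤ ‖φ x‖ * ‖g x - g y‖ + ‖φ x - φ y‖ * ‖g y‖ := by
        rw [← norm_smul, ← norm_smul]
        exact norm_add_le _ _
    _ ≤ |A| * (L * dist x y) + (K * dist x y) * |B| := by gcongr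
    _ = (|A| * L + K * |B|) * dist x y := by ring

theorem LipschitzOnWith.exists_inv_norm_of_isCompact {α E : Type*} [PseudoMetricSpace α]
    [NormedAddCommGroup E] {S : Set α} (hS : IsCompact S) {g : α → E}
    (hg : ∃ K, LipschitzOnWith K g S) (h0 : ∀ x ∈ S, g x ≠ 0) :
    ∃ K, LipschitzOnWith K (fun x => ‖g x‖⁻¹) S := by
  obtain ⟨L, hg⟩ := hg
  obtain ⟨c, hc, hcg⟩ := hS.exists_forall_le' (a := (0 : ℝ)) hg.continuousOn.norm
    fun x hx => norm_pos_iff.2 (h0 x hx)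
  refine ⟨(c⁻¹ * c⁻¹ * L).toNNReal, LipschitzOnWith.of_dist_le_mul fun x hx y hy => ?_⟩
  have h2 := hg.dist_le_mul x hx y hy
  have hx0 := hc.trans_le (hcg x hx)
  have hy0 := hc.trans_le (hcg y hy)
  rw [Real.coe_toNNReal _ (by positivity), Real.dist_eq, inv_sub_inv hx0.ne' hy0.ne', abs_div,
    abs_of_pos (mul_pos hx0 hy0), div_eq_inv_mul, mul_inv]
  refine mul_le_mul_of_nonneg (b := c⁻¹ * c⁻¹) ?_ ?_ (by positivity) (by positivity) |>.trans_eq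
    (mul_assoc _ _ _).symm
  · gcongr
    · exact hcg x hx
    · exact hcg y hy
  · rw [dist_eq_norm, norm_sub_rev] at h2
    exact (abs_norm_sub_norm_le _ _).trans h2

/-- The coordinatewise projection of `ℝ^ι` onto the cube `[-R, R]^ι`. -/
noncomputable def cubeClamp {ι : Type*} (R : ℝ) (x : ι → ℝ) : ι → ℝ := fun i => max (-R) (min R (x i))

section cubeClamp

variable {ι : Type*} {R : ℝ}

theorem cubeClamp_apply_of_le (hR : 0 ≤ R) {x : ι → ℝ} {i : ι} (h : R ≤ x i) :
    cubeClamp R x i = R := by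
  rw [cubeClamp, min_eq_left h, max_eq_right (by linarith)]

theorem cubeClamp_apply_of_le_neg {x : ι → ℝ} {i : ι} (h : x i ≤ -R) :
    cubeClamp R x i = -R := by
  rw [cubeClamp, max_eq_left ((min_le_right _ _).trans h)]

variable [Fintype ι]

theorem lipschitzWith_cubeClamp (R : ℝ) : LipschitzWith 1 (cubeClamp (ι := ι) R) := by
  refine LipschitzWith.of_dist_le_mul fun x y => ?_
  rw [dist_pi_le_iff (by positivity)]
  intro i
  have h := ((LipschitzWith.eval (α := fun _ : ι => ℝ) i).const_min R).const_max (-R)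
  exact h.dist_le_mul x y

theorem cubeClamp_mem_closedBall (hR : 0 ≤ R) (x : ι → ℝ) :
    cubeClamp R x ∈ closedBall (0 : ι → ℝ) R := by
  rw [mem_closedBall_zero_iff, pi_norm_le_iff_of_nonneg hR]
  intro i
  rw [Real.norm_eq_abs, abs_le]
  exact ⟨le_max_left _ _, max_le (by linarith) (min_le_left _ _)⟩

theorem cubeClamp_eq_self {x : ι → ℝ} (hx : x ∈ closedBall (0 : ι → ℝ) R) : cubeClamp R x = x := by
  rw [mem_closedBall_zero_iff] at hx
  ext i
  have := abs_le.1 ((norm_le_pi_norm x i).trans hx)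
  rw [cubeClamp, min_eq_right this.2, max_eq_right this.1]

theorem norm_cubeClamp_of_notMem_ball (hR : 0 < R) {x : ι → ℝ} (hx : x ∉ ball (0 : ι → ℝ) R) :
    ‖cubeClamp R x‖ = R := by
  refine le_antisymm (mem_closedBall_zero_iff.1 (cubeClamp_mem_closedBall hR.le x)) ?_
  rw [mem_ball_zero_iff, pi_norm_lt_iff hR] at hx
  push Not at hx
  obtain ⟨i, hi⟩ := hx
  refine le_trans ?_ (norm_le_pi_norm _ i)
  rw [Real.norm_eq_abs] at hi ⊢
  rcases le_abs'.1 hi with h | h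
  · rw [cubeClamp_apply_of_le_neg h, abs_neg, abs_of_pos hR]
  · rw [cubeClamp_apply_of_le hR.le h, abs_of_pos hR]

end cubeClamp

/-- If `h` had no zero, it could be deformed to the identity across the shell `1 ≤ ‖x‖ ≤ 2`. The
resulting `H` has no zero, and `2 • ‖H x‖⁻¹ • H x` would be a Lipschitz retraction of the cube of
radius 2 onto its boundary. -/
theorem exists_eq_zero_of_lipschitzOnWith {ι : Type*} [Fintype ι] {h : (ι → ℝ) → (ι → ℝ)}
    {K : ℝ≥0} (hh : LipschitzOnWith K h (closedBall 0 1))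
    (hneg : ∀ x ∈ closedBall (0 : ι → ℝ) 1, ∀ i, x i = -1 → h x i < 0)
    (hpos : ∀ x ∈ closedBall (0 : ι → ℝ) 1, ∀ i, x i = 1 → 0 < h x i) :
    ∃ x ∈ closedBall (0 : ι → ℝ) 1, h x = 0 := by
  rcases isEmpty_or_nonempty ι with hι | hι
  · exact ⟨0, by simp, Subsingleton.elim _ _⟩
  by_contra! hne
  set S : Set (ι → ℝ) := closedBall 0 2 with hSdef
  have hS : IsCompact S := isCompact_closedBall 0 2
  set s : (ι → ℝ) → ℝ := fun x => max 0 (min 1 (‖x‖ - 1)) with hs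
  have hs01 : ∀ x, 0 ≤ s x ∧ s x ≤ 1 := fun x =>
    ⟨le_max_left _ _, max_le zero_le_one (min_le_left _ _)⟩
  have hsL : ∃ K, LipschitzWith K s :=
    ⟨_, ((lipschitzWith_one_norm.sub (LipschitzWith.const 1)).const_min 1).const_max 0⟩
  have hsL' : ∃ K, LipschitzWith K fun x => 1 - s x := hsL.imp' _ fun _ h =>
    (LipschitzWith.const 1).sub h
  have hhL : LipschitzWith (K * 1) fun x => h (cubeClamp 1 x) :=
    lipschitzOnWith_univ.1 <| hh.comp (lipschitzWith_cubeClamp 1).lipschitzOnWith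
      fun x _ => cubeClamp_mem_closedBall zero_le_one x
  set H : (ι → ℝ) → (ι → ℝ) := fun x => (1 - s x) • h (cubeClamp 1 x) + s x • x with hH
  have hHL : ∃ K, LipschitzOnWith K H S := by
    obtain ⟨K₁, h₁⟩ := LipschitzOnWith.exists_smul_of_isCompact hS
      (hsL'.imp fun _ h => h.lipschitzOnWith) ⟨_, hhL.lipschitzOnWith⟩
    obtain ⟨K₂, h₂⟩ := LipschitzOnWith.exists_smul_of_isCompact hS
      (hsL.imp fun _ h => h.lipschitzOnWith) ⟨_, LipschitzWith.id.lipschitzOnWith⟩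
    exact ⟨_, h₁.add h₂⟩
  have hH0 : ∀ x, H x ≠ 0 := by
    intro x
    by_cases hx : ‖x‖ ≤ 1
    · have hxs : s x = 0 := max_eq_left ((min_le_right _ _).trans (by linarith))
      have hx1 : x ∈ closedBall (0 : ι → ℝ) 1 := mem_closedBall_zero_iff.2 hx
      simpa [hH, hxs, cubeClamp_eq_self hx1] using hne x hx1
    -- Some `|x i|` exceeds 1, so the clamped point lies on a face where `h` has the sign of `x i`
    -- in coordinate `i`; a convex combination of the two cannot vanish.
    · rw [pi_norm_le_iff_of_nonneg zero_le_one] at hx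
      push Not at hx
      obtain ⟨i, hi⟩ := hx
      obtain ⟨hs0, hs1⟩ := hs01 x
      have hmem := cubeClamp_mem_closedBall zero_le_one x
      intro h0
      have h0i : (1 - s x) * h (cubeClamp 1 x) i + s x * x i = 0 := congrFun h0 i
      rcases lt_abs.1 hi with h' | h'
      · have := hpos _ hmem i (cubeClamp_apply_of_le zero_le_one h'.le)
        rcases hs0.eq_or_lt with h'' | h''
        · rw [← h''] at h0i
          linarith
        · have := mul_pos h'' (zero_lt_one.trans h')
          have := mul_nonneg (sub_nonneg.2 hs1) (hpos _ hmem i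
            (cubeClamp_apply_of_le zero_le_one h'.le)).le
          linarith
      · have hx1 : x i ≤ -1 := by linarith
        have := hneg _ hmem i (cubeClamp_apply_of_le_neg hx1)
        rcases hs0.eq_or_lt with h'' | h''
        · rw [← h''] at h0i
          linarith
        · have := mul_pos_of_neg_of_neg (a := -s x) (b := x i) (by linarith) (by linarith)
          have := mul_nonneg (sub_nonneg.2 hs1) (neg_nonneg.2 (hneg _ hmem i
            (cubeClamp_apply_of_le_neg hx1)).le)
          linarith
  obtain ⟨L, hL⟩ : ∃ L, LipschitzOnWith L (fun x => ‖H x‖⁻¹ • H x) S :=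
    LipschitzOnWith.exists_smul_of_isCompact hS
      (LipschitzOnWith.exists_inv_norm_of_isCompact hS hHL fun x _ => hH0 x) hHL
  have hL2 : LipschitzOnWith (‖(2 : ℝ)‖₊ * L) (fun x => (2 : ℝ) • ‖H x‖⁻¹ • H x) S :=
    (lipschitzWith_smul (2 : ℝ)).comp_lipschitzOnWith hL
  set u₀ : (ι → ℝ) → (ι → ℝ) := fun x => (2 : ℝ) • ‖H x‖⁻¹ • H x - x with hu₀
  have hu₀L : LipschitzOnWith (‖(2 : ℝ)‖₊ * L + 1) u₀ S :=
    hL2.sub LipschitzWith.id.lipschitzOnWith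
  -- Clamping makes the displacement globally Lipschitz, and zero outside the open cube because `H`
  -- is the identity where the norm is 2.
  have huL : LipschitzWith ((‖(2 : ℝ)‖₊ * L + 1) * 1) fun x => u₀ (cubeClamp 2 x) :=
    lipschitzOnWith_univ.1 <| hu₀L.comp (lipschitzWith_cubeClamp 2).lipschitzOnWith
      fun x _ => cubeClamp_mem_closedBall zero_le_two x
  obtain ⟨x, hx, hx2⟩ := not_lipschitz_retraction huL two_pos fun x hx => by
    have hn := norm_cubeClamp_of_notMem_ball two_pos hx
    have hs1 : s (cubeClamp 2 x) = 1 := by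
      simp only [hs, hn]
      norm_num
    have hHx : H (cubeClamp 2 x) = cubeClamp 2 x := by
      simp [hH, hs1]
    simp only [hu₀, hHx, hn]
    simp
  apply hx2
  rw [cubeClamp_eq_self (ball_subset_closedBall hx)]
  simp only [hu₀, add_sub_cancel, norm_smul, norm_inv, norm_norm]
  rw [inv_mul_cancel₀ (norm_ne_zero_iff.2 (hH0 x))]
  norm_num

/-- Continuous real functions are uniformly approximated by `C^1` functions on compact sets. -/
theorem exists_contDiff_near {E : Type*} [NormedAddCommGroup E] [NormedSpace ℝ E] {f : E → ℝ}
    (hf : Continuous f) {S : Set E} (hS : IsCompact S) {η : ℝ} (hη : 0 < η) :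
    ∃ g : E → ℝ, ContDiff ℝ 1 g ∧ ∀ x ∈ S, |g x - f x| < η := by
  let A : Subalgebra ℝ C(E, ℝ) :=
    { carrier := {g | ContDiff ℝ 1 fun x => g x}
      mul_mem' := fun {a b} ha hb =>
        show ContDiff ℝ 1 fun x => a x * b x from
          (show ContDiff ℝ 1 fun x => a x from ha).mul (show ContDiff ℝ 1 fun x => b x from hb)
      add_mem' := fun {a b} ha hb =>
        show ContDiff ℝ 1 fun x => a x + b x from
          (show ContDiff ℝ 1 fun x => a x from ha).add (show ContDiff ℝ 1 fun x => b x from hb)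
      algebraMap_mem' := fun r =>
        show ContDiff ℝ 1 fun _ : E => r from contDiff_const }
  have hA : A.SeparatesPoints := by
    intro x y hxy
    obtain ⟨l, hl⟩ := SeparatingDual.exists_separating_of_ne (R := ℝ) hxy
    exact ⟨l, ⟨(⟨l, l.continuous⟩ : C(E, ℝ)), show ContDiff ℝ 1 fun x => l x from l.contDiff,
      rfl⟩, hl⟩
  obtain ⟨g, hg, hgf⟩ :=
    ContinuousMap.exists_mem_subalgebra_near_continuous_of_isCompact_of_separatesPoints
      hA ⟨f, hf⟩ hS hη
  exact ⟨g, hg, hgf⟩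

/-- The **Poincaré–Miranda theorem** on the cube `[-1, 1]^ι`. -/
theorem poincare_miranda {ι : Type*} [Fintype ι] {h : (ι → ℝ) → (ι → ℝ)} (hh : Continuous h)
    (hneg : ∀ x ∈ closedBall (0 : ι → ℝ) 1, ∀ i, x i = -1 → h x i ≤ 0)
    (hpos : ∀ x ∈ closedBall (0 : ι → ℝ) 1, ∀ i, x i = 1 → 0 ≤ h x i) :
    ∃ x ∈ closedBall (0 : ι → ℝ) 1, h x = 0 := by
  have hC : IsCompact (closedBall (0 : ι → ℝ) 1) := isCompact_closedBall 0 1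
  by_contra! hne
  obtain ⟨c, hc, hch⟩ := hC.exists_forall_le' (a := (0 : ℝ)) hh.norm.continuousOn
    fun x hx => norm_pos_iff.2 (hne x hx)
  -- One `c / 3` pays for the smoothing, the other for the tilt `c / 3 * x i` that makes the face
  -- inequalities strict. At a zero of the perturbed map `‖h x‖ ≤ 2 * (c / 3) < c`.
  have hη : 0 < c / 3 := by positivity
  choose g hg hgh using fun i => exists_contDiff_near ((continuous_apply i).comp hh) hC hη
  have hsmooth : ContDiff ℝ 1 fun x : ι → ℝ => (fun i => g i x + c / 3 * x i : ι → ℝ) :=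
    contDiff_pi.2 fun i => (hg i).add (contDiff_const.mul (contDiff_apply ℝ ℝ i))
  obtain ⟨K, hK⟩ := hsmooth.contDiffOn.exists_lipschitzOnWith one_ne_zero
    (convex_closedBall (0 : ι → ℝ) 1) hC
  have hgh' : ∀ x ∈ closedBall (0 : ι → ℝ) 1, ∀ i, h x i - c / 3 < g i x ∧ g i x < h x i + c / 3 :=
    fun x hx i => by
      have := abs_lt.1 (hgh i x hx)
      simp only [Function.comp_apply] at this
      constructor <;> linarith
  obtain ⟨x, hx, hx0⟩ := exists_eq_zero_of_lipschitzOnWith hK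
    (fun x hx i hi => by
      have := hneg x hx i hi
      have := hgh' x hx i
      rw [hi]
      linarith)
    (fun x hx i hi => by
      have := hpos x hx i hi
      have := hgh' x hx i
      rw [hi]
      linarith)
  have hle : ‖h x‖ ≤ 2 * (c / 3) := by
    rw [pi_norm_le_iff_of_nonneg (by positivity)]
    intro i
    have h1 : g i x + c / 3 * x i = 0 := congrFun hx0 i
    have h2 := hgh' x hx i
    have h3 := abs_le.1 ((norm_le_pi_norm x i).trans (mem_closedBall_zero_iff.1 hx))
    rw [Real.norm_eq_abs, abs_le]
    constructor <;> nlinarith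
  linarith [hch x hx]

/-- If each coordinate of a continuous map has strict opposite signs on the corresponding opposite
faces of the cube, the image of the cube contains a ball around the origin. -/
theorem exists_ball_subset_image_cube {ι : Type*} [Fintype ι] {h : (ι → ℝ) → (ι → ℝ)}
    (hh : Continuous h) (hneg : ∀ x ∈ closedBall (0 : ι → ℝ) 1, ∀ i, x i = -1 → h x i < 0)
    (hpos : ∀ x ∈ closedBall (0 : ι → ℝ) 1, ∀ i, x i = 1 → 0 < h x i) :
    ∃ δ > 0, ball (0 : ι → ℝ) δ ⊆ h '' closedBall 0 1 := by
  have hface : ∀ (i : ι) (a : ℝ), IsCompact (closedBall (0 : ι → ℝ) 1 ∩ {x | x i = a}) :=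
    fun i a => (isCompact_closedBall 0 1).inter_right
      (isClosed_eq (continuous_apply i) continuous_const)
  have hδ : ∀ i, ∀ᶠ δ in 𝓝[>] (0 : ℝ), (∀ x ∈ closedBall (0 : ι → ℝ) 1, x i = -1 → h x i ≤ -δ) ∧
      ∀ x ∈ closedBall (0 : ι → ℝ) 1, x i = 1 → δ ≤ h x i := by
    intro i
    obtain ⟨a, ha, hah⟩ := (hface i 1).exists_forall_le' (a := (0 : ℝ))
      ((continuous_apply i).comp hh).continuousOn fun x hx => hpos x hx.1 i hx.2
    obtain ⟨b, hb, hbh⟩ := (hface i (-1)).exists_forall_le' (a := (0 : ℝ))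
      ((continuous_apply i).comp hh).neg.continuousOn fun x hx => neg_pos.2 (hneg x hx.1 i hx.2)
    filter_upwards [nhdsWithin_le_nhds (gt_mem_nhds ha), nhdsWithin_le_nhds (gt_mem_nhds hb)]
      with δ hδa hδb
    refine ⟨fun x hx hxi => ?_, fun x hx hxi => hδa.le.trans (hah x ⟨hx, hxi⟩)⟩
    have : b ≤ -(h x i) := hbh x ⟨hx, hxi⟩
    linarith
  obtain ⟨δ, hδ, hδ0⟩ := ((Filter.eventually_all.2 hδ).and self_mem_nhdsWithin).exists
  refine ⟨δ, hδ0, fun y hy => ?_⟩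
  have hyi : ∀ i, -δ < y i ∧ y i < δ := fun i =>
    abs_lt.1 ((norm_le_pi_norm y i).trans_lt (mem_ball_zero_iff.1 hy))
  obtain ⟨x, hx, hxy⟩ := poincare_miranda (h := fun x => h x - y) (hh.sub continuous_const)
    (fun x hx i hi => by
      have := (hδ i).1 x hx hi
      have := hyi i
      simp only [Pi.sub_apply]
      linarith)
    (fun x hx i hi => by
      have := (hδ i).2 x hx hi
      have := hyi i
      simp only [Pi.sub_apply]
      linarith)
  exact ⟨x, hx, sub_eq_zero.1 hxy⟩

/-! ### Hausdorff dimension of polyhedra and separation of faces -/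

theorem dimH_convexHull_finset_le {E : Type*} [NormedAddCommGroup E] [NormedSpace ℝ E]
    [FiniteDimensional ℝ E] {s : Finset E} {k : ℕ} (hs : s.card ≤ k + 1) :
    dimH (convexHull ℝ (s : Set E)) ≤ k := by
  classical
  rcases s.eq_empty_or_nonempty with rfl | hne
  · simp
  obtain ⟨m, hm⟩ := Nat.exists_eq_succ_of_ne_zero (Finset.card_pos.2 hne).ne'
  rw [Real.Convex.dimH_eq_finrank_vectorSpan (convex_convexHull ℝ _)
    (convexHull_nonempty_iff.2 (Finset.coe_nonempty.2 hne)),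
    ← direction_affineSpan, affineSpan_convexHull, direction_affineSpan]
  have := finrank_vectorSpan_image_finset_le ℝ (id : E → E) s hm
  rw [Finset.image_id] at this
  exact_mod_cast this.trans (by omega)

/-- By the Lindelöf property, countably many of the neighbourhoods cover the space, and each meets
finitely many simplices. Countability lets `dimH` be computed as a supremum over the faces. -/
theorem IsLocallyFiniteComplex.countable_faces {N : ℕ}
    {K : Geometry.SimplicialComplex ℝ (EuclideanSpace ℝ (Fin N))} (hK : IsLocallyFiniteComplex K) :
    K.faces.Countable := by
  choose! U hU hfin using hK
  obtain ⟨t, htK, ht, hcov⟩ := TopologicalSpace.countable_cover_nhdsWithin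
    (f := U) fun x hx => mem_nhdsWithin_of_mem_nhds (hU x hx)
  refine (ht.biUnion fun x hx => (hfin x (htK hx)).countable).mono fun s hs => ?_
  obtain ⟨y, hy⟩ := K.nonempty_of_mem_faces hs
  obtain ⟨x, hxt, hyx⟩ := mem_iUnion₂.1 (hcov (K.subset_space hs hy))
  exact mem_iUnion₂.2 ⟨x, hxt, hs, y, subset_convexHull ℝ _ hy, hyx⟩

theorem IsPolyhedron.dimH_le {N k : ℕ} {P : Set (EuclideanSpace ℝ (Fin N))}
    (hP : IsPolyhedron k P) : dimH P ≤ k := by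
  obtain ⟨K, hK, hdim, rfl⟩ := hP
  rw [Geometry.SimplicialComplex.space, dimH_bUnion hK.countable_faces]
  exact iSup₂_le fun s hs => dimH_convexHull_finset_le (hdim.2 s hs)

/-- A map from a cube to a polyhedron which never identifies points of opposite faces forces the
dimension of the polyhedron to be at least that of the cube. -/
theorem IsPolyhedron.card_le_of_separates_faces {ι : Type*} [Fintype ι] {N k : ℕ}
    {P : Set (EuclideanSpace ℝ (Fin N))} (hP : IsPolyhedron k P) {f : (ι → ℝ) → P}
    (hf : Continuous f)
    (hsep : ∀ x ∈ closedBall (0 : ι → ℝ) 1, ∀ y ∈ closedBall (0 : ι → ℝ) 1, ∀ i,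
      x i = 1 → y i = -1 → f x ≠ f y) : Fintype.card ι ≤ k := by
  classical
  set F : (ι → ℝ) → EuclideanSpace ℝ (Fin N) := fun x => f x with hF
  have hFc : Continuous F := continuous_subtype_val.comp hf
  set A : ℝ → ι → Set (EuclideanSpace ℝ (Fin N)) := fun a i =>
    F '' (closedBall (0 : ι → ℝ) 1 ∩ {x | x i = a}) with hA
  have hAc : ∀ a i, IsClosed (A a i) := fun a i =>
    (((isCompact_closedBall 0 1).inter_right
      (isClosed_eq (continuous_apply i) continuous_const)).image hFc).isClosed
  -- `infDist` to the empty set is 0, so positivity off a closed set needs nonempty faces.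
  have hne : ∀ (a : ℝ) (i : ι), |a| ≤ 1 → (A a i).Nonempty := fun a i ha =>
    ⟨_, _, ⟨mem_closedBall_zero_iff.2 <| (pi_norm_const_le a).trans ha, rfl⟩, rfl⟩
  set G : EuclideanSpace ℝ (Fin N) → (ι → ℝ) := fun y i =>
    infDist y (A (-1) i) - infDist y (A 1 i) with hG
  have hGL : LipschitzWith 2 G := by
    refine LipschitzWith.of_dist_le_mul fun x y => ?_
    rw [dist_pi_le_iff (by positivity)]
    intro i
    have := ((lipschitz_infDist_pt (A (-1) i)).sub (lipschitz_infDist_pt (A 1 i))).dist_le_mul x y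
    rwa [show (1 + 1 : ℝ≥0) = 2 by norm_num] at this
  obtain ⟨δ, hδ, hsub⟩ := exists_ball_subset_image_cube (h := G ∘ F) (hGL.continuous.comp hFc)
    (fun x hx i hi => by
      have hmem : F x ∈ A (-1) i := ⟨x, ⟨hx, hi⟩, rfl⟩
      have hnot : F x ∉ A 1 i := by
        rintro ⟨y, ⟨hy, hyi⟩, hyx⟩
        exact hsep y hy x hx i hyi hi (Subtype.ext hyx)
      have := ((hAc 1 i).notMem_iff_infDist_pos (hne 1 i (by simp))).1 hnot
      simp only [hG, Function.comp_apply, infDist_zero_of_mem hmem]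
      linarith)
    (fun x hx i hi => by
      have hmem : F x ∈ A 1 i := ⟨x, ⟨hx, hi⟩, rfl⟩
      have hnot : F x ∉ A (-1) i := by
        rintro ⟨y, ⟨hy, hyi⟩, hyx⟩
        exact hsep x hx y hy i hi hyi (Subtype.ext hyx.symm)
      have := ((hAc (-1) i).notMem_iff_infDist_pos (hne (-1) i (by simp))).1 hnot
      simp only [hG, Function.comp_apply, infDist_zero_of_mem hmem]
      linarith)
  have hsub' : ball (0 : ι → ℝ) δ ⊆ G '' P := by
    refine hsub.trans ?_
    rintro _ ⟨x, -, rfl⟩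
    exact ⟨F x, (f x).2, rfl⟩
  have h1 := (dimH_mono hsub').trans ((hGL.dimH_image_le P).trans hP.dimH_le)
  rw [Real.dimH_ball_pi (0 : ι → ℝ) hδ] at h1
  exact_mod_cast h1

/-! ### Lower bound: a large cube inside the ball -/

/-- The map from `ℝ^j` onto the cube of half-side `a` in a `j`-dimensional coordinate subspace
of `ℝ^n`. -/
noncomputable def cubeToPi (j n : ℕ) (a : ℝ) (x : Fin j → ℝ) : Fin n → ℝ := fun i =>
  if h : (i : ℕ) < j then a * cubeClamp 1 x ⟨i, h⟩ else 0

theorem continuous_cubeToPi (j n : ℕ) (a : ℝ) : Continuous (cubeToPi j n a) := by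
  refine continuous_pi fun i => ?_
  by_cases h : (i : ℕ) < j
  · simp only [cubeToPi, h, dif_pos]
    exact continuous_const.mul
      ((continuous_apply _).comp (lipschitzWith_cubeClamp 1).continuous)
  · simp only [cubeToPi, h, dif_neg, not_false_eq_true]
    exact continuous_const

theorem cubeToPi_mem_lpBall {p a : ℝ} (hp : 0 < p) (ha : 0 ≤ a) {j : ℕ} (n : ℕ)
    (haj : j * a ^ p ≤ 1) (x : Fin j → ℝ) : cubeToPi j n a x ∈ lpBall p n := by
  classical
  have hap : 0 ≤ a ^ p := Real.rpow_nonneg ha p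
  have hle : ∀ i : Fin n, |cubeToPi j n a x i| ^ p ≤ if (i : ℕ) < j then a ^ p else 0 := by
    intro i
    by_cases h : (i : ℕ) < j
    · simp only [cubeToPi, h, dif_pos, if_true]
      refine Real.rpow_le_rpow (abs_nonneg _) ?_ hp.le
      rw [abs_mul, abs_of_nonneg ha]
      refine mul_le_of_le_one_right ha ?_
      exact (norm_le_pi_norm (cubeClamp 1 x) ⟨i, h⟩).trans
        (mem_closedBall_zero_iff.1 (cubeClamp_mem_closedBall zero_le_one x))
    · simp [cubeToPi, h, Real.zero_rpow hp.ne']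
  refine (Finset.sum_le_sum fun i _ => hle i).trans ?_
  rw [← Finset.sum_filter, Finset.sum_const, nsmul_eq_mul]
  refine le_trans ?_ haj
  gcongr
  calc (Finset.univ.filter fun i : Fin n => (i : ℕ) < j).card
      = ((Finset.univ.filter fun i : Fin n => (i : ℕ) < j).map Fin.valEmbedding).card := by simp
    _ ≤ (Finset.range j).card := Finset.card_le_card fun i hi => by
        obtain ⟨l, hl, rfl⟩ := Finset.mem_map.1 hi
        simpa using hl
    _ = j := Finset.card_range j

theorem le_of_mem_widimSet_lpBall {p ε : ℝ} (hp : 0 < p) (hε : 0 < ε) {n j k : ℕ} (hjn : j ≤ n)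
    (hj : (j : ℝ) < (2 / ε) ^ p) (hk : k ∈ widimSet (lpBall p n) ε) : j ≤ k := by
  rcases Nat.eq_zero_or_pos j with rfl | hj0
  · exact Nat.zero_le k
  obtain ⟨N, P, f, hP, hf⟩ := hk
  have hj0' : (0 : ℝ) < j := by exact_mod_cast hj0
  -- The largest half-side with `j * a ^ p ≤ 1`; then `ε < 2 * a` is equivalent to `j < (2 / ε) ^
  -- p`.
  set a : ℝ := ((j : ℝ) ^ p⁻¹)⁻¹ with ha
  have ha0 : 0 < a := by positivity
  have haj : j * a ^ p ≤ 1 := by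
    rw [ha, Real.inv_rpow (by positivity), Real.rpow_inv_rpow hj0'.le hp.ne',
      mul_inv_cancel₀ hj0'.ne']
  have hεa : ε < 2 * a := by
    have h1 : (j : ℝ) ^ p⁻¹ < 2 / ε := by
      rwa [Real.rpow_inv_lt_iff_of_pos hj0'.le (by positivity) hp]
    rw [lt_div_iff₀ hε] at h1
    rw [ha, ← div_eq_mul_inv, lt_div_iff₀ (by positivity)]
    linarith
  have := hP.card_le_of_separates_faces (ι := Fin j)
    (f := fun x => f ⟨cubeToPi j n a x, cubeToPi_mem_lpBall hp ha0.le n haj x⟩)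
    (hf.continuous.comp ((continuous_cubeToPi j n a).subtype_mk _))
    (fun x hx y hy i hxi hyi hfxy => by
      set X : lpBall p n := ⟨cubeToPi j n a x, cubeToPi_mem_lpBall hp ha0.le n haj x⟩ with hX
      set Y : lpBall p n := ⟨cubeToPi j n a y, cubeToPi_mem_lpBall hp ha0.le n haj y⟩ with hY
      have hXY : dist X Y ≤ ε := by
        have h1 := (edist_le_ediam_of_mem (s := f ⁻¹' {f Y}) (x := X) (y := Y) hfxy rfl).trans
          (hf.ediam_fiber_le _)
        rwa [edist_dist, ENNReal.ofReal_le_ofReal_iff hε.le] at h1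
      have h2 := (dist_le_pi_dist X.1 Y.1 ⟨i, i.2.trans_le hjn⟩).trans hXY
      simp only [hX, hY, cubeToPi, cubeClamp_eq_self hx, cubeClamp_eq_self hy, i.2, dif_pos, Fin.eta,
        hxi, hyi, Real.dist_eq] at h2
      rw [show a * 1 - a * -1 = 2 * a by ring, abs_of_pos (by positivity)] at h2
      linarith)
  simpa using this

/-! ### Upper bound: soft thresholding into a skeleton -/

/-- The `k`-skeleton of the simplex spanned by an affinely independent finite set. -/
noncomputable def simplexSkeleton {E : Type*} [AddCommGroup E] [Module ℝ E] (V : Finset E)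
    (hV : AffineIndependent ℝ (Subtype.val : ((V : Set E) : Type _) → E)) (k : ℕ) :
    Geometry.SimplicialComplex ℝ E := by
  classical
  exact Geometry.SimplicialComplex.ofAffineIndependent
    { faces := {s | s.Nonempty ∧ s ⊆ V ∧ s.card ≤ k + 1}
      isRelLowerSet_faces := fun s hs => ⟨hs.1, fun t hts ht =>
        ⟨ht, hts.trans hs.2.1, (Finset.card_le_card hts).trans hs.2.2⟩⟩ }
    (hV.mono (iUnion₂_subset fun s hs => Finset.coe_subset.2 hs.2.1))

/-- Dimension exactly `k` requires a `k`-simplex, hence at least `k + 1` vertices. -/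
theorem isPolyhedron_simplexSkeleton {N k : ℕ} {V : Finset (EuclideanSpace ℝ (Fin N))}
    (hV : AffineIndependent ℝ (Subtype.val : ((V : Set (EuclideanSpace ℝ (Fin N))) : Type _) → _))
    (hk : k + 1 ≤ V.card) : IsPolyhedron k (simplexSkeleton V hV k).space := by
  refine ⟨simplexSkeleton V hV k, fun x _ => ⟨univ, Filter.univ_mem, ?_⟩,
    ⟨?_, fun s hs => hs.2.2⟩, rfl⟩
  · exact V.powerset.finite_toSet.subset fun s hs => Finset.mem_powerset.2 hs.1.2.1
  · obtain ⟨s, hsV, hs⟩ := Finset.exists_subset_card_eq hk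
    exact ⟨s, ⟨Finset.card_pos.1 (by omega), hsV, hs.le⟩, hs⟩

/-- An `ε`-embedding into the `k`-skeleton of a standard simplex, in barycentric coordinates. -/
theorem mem_widimSet_of_stdSimplex {X : Type*} [MetricSpace X] {ε : ℝ} {ι : Type*} [Fintype ι]
    {k : ℕ} (hk : k + 1 ≤ Fintype.card ι) {c : X → ι → ℝ} (hc : Continuous c)
    (hmem : ∀ x, c x ∈ stdSimplex ℝ ι) (hsupp : ∀ x, (Function.support (c x)).ncard ≤ k + 1)
    (hfib : ∀ x y, c x = c y → dist x y ≤ ε) : k ∈ widimSet X ε := by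
  classical
  set N := Fintype.card ι
  let e : ι ≃ Fin N := Fintype.equivFin ι
  set v : ι → EuclideanSpace ℝ (Fin N) := fun i => EuclideanSpace.basisFun (Fin N) ℝ (e i) with hv
  have hlin : LinearIndependent ℝ v :=
    (EuclideanSpace.basisFun (Fin N) ℝ).orthonormal.linearIndependent.comp e e.injective
  have haff : AffineIndependent ℝ (Subtype.val :
      (((Finset.univ.image v : Finset _) : Set (EuclideanSpace ℝ (Fin N))) : Type _) → EuclideanSpace ℝ (Fin N)) := by
    rw [Finset.coe_image, Finset.coe_univ, image_univ]
    exact hlin.affineIndependent.range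
  have hcard : (Finset.univ.image v).card = N := by
    rw [Finset.card_image_of_injective _ hlin.injective, Finset.card_univ]
  set F : X → EuclideanSpace ℝ (Fin N) := fun x => ∑ i, c x i • v i with hF
  have hFc : Continuous F := continuous_finsetSum _ fun i _ =>
    ((continuous_apply i).comp hc).smul continuous_const
  have hFmem : ∀ x, F x ∈ (simplexSkeleton (Finset.univ.image v) haff k).space := by
    intro x
    have hx := hmem x
    set T : Finset ι := Finset.univ.filter fun i => c x i ≠ 0 with hT
    have hTsum : ∑ i ∈ T, c x i = 1 := by
      rw [← hx.2, hT, Finset.sum_filter_ne_zero]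
    have hTne : T.Nonempty := by
      by_contra h
      rw [Finset.not_nonempty_iff_eq_empty] at h
      simp [h] at hTsum
    have hTcard : T.card ≤ k + 1 := by
      refine le_trans (le_of_eq ?_) (hsupp x)
      rw [← ncard_coe_finset]
      congr 1
      ext i
      simp [hT]
    refine Geometry.SimplicialComplex.mem_space_iff.2 ⟨T.image v, ⟨hTne.image v,
      Finset.image_subset_image (Finset.subset_univ T), Finset.card_image_le.trans hTcard⟩, ?_⟩
    have hFx : F x = ∑ i ∈ T, c x i • v i := by
      refine (Finset.sum_subset (Finset.subset_univ T) fun i _ hi => ?_).symm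
      have : c x i = 0 := by simpa [hT] using hi
      rw [this, zero_smul]
    rw [hFx]
    exact (convex_convexHull ℝ _).sum_mem (fun i _ => hx.1 i) hTsum fun i hi =>
      subset_convexHull ℝ _ (Finset.mem_coe.2 (Finset.mem_image_of_mem v hi))
  refine ⟨N, _, fun x => ⟨F x, hFmem x⟩, isPolyhedron_simplexSkeleton haff (hk.trans_eq hcard.symm),
    hFc.subtype_mk _, fun y => ediam_le fun a ha b hb => ?_⟩
  have hab : F a = F b := congrArg Subtype.val (ha.trans hb.symm)
  rw [edist_dist]
  refine ENNReal.ofReal_le_ofReal (hfib a b (funext fun i => ?_))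
  have := Fintype.linearIndependent_iff.1 hlin (fun i => c a i - c b i) (by
    simp only [sub_smul, Finset.sum_sub_distrib]
    exact sub_eq_zero.2 hab) i
  exact sub_eq_zero.1 this

/-- Barycentric coordinates of the soft thresholding of `x` at level `τ`, with the positive and
negative parts of each coordinate kept apart. -/
noncomputable def softThreshold {n : ℕ} (τ : ℝ) (x : Fin n → ℝ) : Option (Fin n ⊕ Fin n) → ℝ
  | some (Sum.inl i) => (n : ℝ)⁻¹ * max (x i - τ) 0
  | some (Sum.inr i) => (n : ℝ)⁻¹ * max (-x i - τ) 0
  | none => 1 - ∑ i, (n : ℝ)⁻¹ * (max (x i - τ) 0 + max (-x i - τ) 0)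

theorem continuous_softThreshold {n : ℕ} (τ : ℝ) : Continuous (softThreshold (n := n) τ) := by
  refine continuous_pi fun o => ?_
  rcases o with _ | i | i <;> simp only [softThreshold] <;> fun_prop

/-- For each `i` at most one of the two parts is nonzero and it is at most 1, so the factor `n⁻¹`
leaves a nonnegative weight for the vertex `none`. -/
theorem softThreshold_mem_stdSimplex {n : ℕ} (hn : 1 ≤ n) {τ : ℝ} (hτ : 0 ≤ τ) {x : Fin n → ℝ}
    (hx : ∀ i, |x i| ≤ 1) : softThreshold τ x ∈ stdSimplex ℝ (Option (Fin n ⊕ Fin n)) := by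
  have hn0 : (0 : ℝ) < n := by exact_mod_cast hn
  constructor
  · rintro (_ | i | i)
    · simp only [softThreshold, sub_nonneg]
      calc ∑ i, (n : ℝ)⁻¹ * (max (x i - τ) 0 + max (-x i - τ) 0) ≤ ∑ _i : Fin n, (n : ℝ)⁻¹ * 1 := by
            gcongr with i
            have := abs_le.1 (hx i)
            rcases max_cases (x i - τ) 0 with h | h <;> rcases max_cases (-x i - τ) 0 with h' | h' <;>
              linarith
        _ = 1 := by simp [hn0.ne']
    · exact mul_nonneg (by positivity) (le_max_right _ _)
    · exact mul_nonneg (by positivity) (le_max_right _ _)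
  · rw [Fintype.sum_option, Fintype.sum_sum_type]
    simp only [softThreshold, mul_add, Finset.sum_add_distrib]
    ring

/-- Each large coordinate uses one of its two vertices, chosen by sign; the extra 1 is the vertex
`none`. -/
theorem ncard_support_softThreshold_le {n : ℕ} {τ : ℝ} (hτ : 0 ≤ τ) (x : Fin n → ℝ) :
    (Function.support (softThreshold τ x)).ncard ≤
      (Finset.univ.filter fun i => τ < |x i|).card + 1 := by
  classical
  set B : Finset (Fin n) := Finset.univ.filter fun i => τ < |x i| with hB
  set g : Fin n → Option (Fin n ⊕ Fin n) := fun i =>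
    if 0 < x i then some (Sum.inl i) else some (Sum.inr i) with hg
  have hsub : Function.support (softThreshold τ x) ⊆ (insert none (B.image g) : Finset _) := by
    intro o ho
    rcases o with _ | i | i
    · simp
    · have h : τ < x i := by
        by_contra! h
        exact ho (by simp [softThreshold, h])
      have hi : i ∈ B := by simpa [hB] using h.trans_le (le_abs_self _)
      have hgi : g i = some (Sum.inl i) := if_pos (hτ.trans_lt h)
      exact Finset.mem_coe.2 (Finset.mem_insert_of_mem (hgi ▸ Finset.mem_image_of_mem g hi))
    · have h : τ < -x i := by
        by_contra! h
        exact ho (by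
          simp only [softThreshold]
          rw [max_eq_right (by linarith), mul_zero])
      have hi : i ∈ B := by simpa [hB] using h.trans_le (neg_le_abs _)
      have hgi : g i = some (Sum.inr i) := if_neg (by linarith)
      exact Finset.mem_coe.2 (Finset.mem_insert_of_mem (hgi ▸ Finset.mem_image_of_mem g hi))
  refine (ncard_le_ncard hsub (Finset.finite_toSet _)).trans ?_
  rw [ncard_coe_finset]
  exact (Finset.card_insert_le _ _).trans (Nat.succ_le_succ Finset.card_image_le)

theorem dist_le_of_softThreshold_eq {n : ℕ} (hn : 1 ≤ n) {τ : ℝ} (hτ : 0 ≤ τ) {x y : Fin n → ℝ}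
    (h : softThreshold τ x = softThreshold τ y) : dist x y ≤ 2 * τ := by
  have hn0 : (n : ℝ)⁻¹ ≠ 0 := by positivity
  rw [dist_pi_le_iff (by positivity)]
  intro i
  have h1 : max (x i - τ) 0 = max (y i - τ) 0 :=
    mul_left_cancel₀ hn0 (congrFun h (some (Sum.inl i)))
  have h2 : max (-x i - τ) 0 = max (-y i - τ) 0 :=
    mul_left_cancel₀ hn0 (congrFun h (some (Sum.inr i)))
  rw [Real.dist_eq, abs_le]
  constructor <;>
  rcases max_cases (x i - τ) 0 with h3 | h3 <;> rcases max_cases (y i - τ) 0 with h4 | h4 <;>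
  rcases max_cases (-x i - τ) 0 with h5 | h5 <;> rcases max_cases (-y i - τ) 0 with h6 | h6 <;>
  linarith

theorem abs_le_one_of_mem_lpBall {p : ℝ} (hp : 0 < p) {n : ℕ} {x : Fin n → ℝ} (hx : x ∈ lpBall p n)
    (i : Fin n) : |x i| ≤ 1 := by
  have h1 : |x i| ^ p ≤ 1 := (Finset.single_le_sum (f := fun k => |x k| ^ p)
    (fun k _ => Real.rpow_nonneg (abs_nonneg _) p) (Finset.mem_univ i)).trans hx
  by_contra! h
  exact absurd (Real.one_lt_rpow h hp) h1.not_gt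

/-- The strict threshold gives `B.card * τ ^ p < 1` when `B` is nonempty; this strictness produces
the `- 1` after the ceiling. -/
theorem card_lt_abs_of_mem_lpBall_le {p : ℝ} (hp : 0 < p) {n : ℕ} {x : Fin n → ℝ}
    (hx : x ∈ lpBall p n) {τ : ℝ} (hτ : 0 < τ) :
    (Finset.univ.filter fun i => τ < |x i|).card ≤ ⌈τ⁻¹ ^ p⌉₊ - 1 := by
  set B : Finset (Fin n) := Finset.univ.filter fun i => τ < |x i| with hB
  rcases B.eq_empty_or_nonempty with h | hne
  · simp [h]
  have hτp : 0 < τ ^ p := Real.rpow_pos_of_pos hτ p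
  have h1 : B.card * τ ^ p < 1 := by
    calc B.card * τ ^ p = ∑ _i ∈ B, τ ^ p := by simp
      _ < ∑ i ∈ B, |x i| ^ p := Finset.sum_lt_sum_of_nonempty hne fun i hi =>
          Real.rpow_lt_rpow hτ.le (Finset.mem_filter.1 hi).2 hp
      _ ≤ ∑ i, |x i| ^ p := Finset.sum_le_sum_of_subset_of_nonneg (Finset.subset_univ B)
          fun i _ _ => Real.rpow_nonneg (abs_nonneg _) p
      _ ≤ 1 := hx
  have h2 : (B.card : ℝ) < τ⁻¹ ^ p := by
    rwa [Real.inv_rpow hτ.le, ← one_div, lt_div_iff₀ hτp]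
  have := Nat.lt_ceil.2 h2
  omega

theorem min_mem_widimSet_lpBall {p ε : ℝ} (hp : 0 < p) (hε : 0 < ε) {n : ℕ} (hn : 1 ≤ n) :
    min n (⌈(2 / ε) ^ p⌉₊ - 1) ∈ widimSet (lpBall p n) ε := by
  have hτ : 0 < ε / 2 := by positivity
  refine mem_widimSet_of_stdSimplex (ι := Option (Fin n ⊕ Fin n)) (by simp)
    (c := fun x => softThreshold (ε / 2) x.1)
    ((continuous_softThreshold _).comp continuous_subtype_val)
    (fun x => softThreshold_mem_stdSimplex hn hτ.le (abs_le_one_of_mem_lpBall hp x.2))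
    (fun x => (ncard_support_softThreshold_le hτ.le x.1).trans (Nat.succ_le_succ (le_min ?_ ?_)))
    (fun x y hxy => ?_)
  · exact (Finset.card_le_univ _).trans_eq (Fintype.card_fin n)
  · exact (card_lt_abs_of_mem_lpBall_le hp x.2 hτ).trans_eq (by rw [inv_div])
  · exact (dist_le_of_softThreshold_eq hn hτ.le hxy).trans_eq (by ring)

theorem corollary2 (p : ℝ) (hp : 1 ≤ p) (n : ℕ) (hn : 1 ≤ n) (ε : ℝ) (hε : 0 < ε) :
    widim (lpBall p n) ε = ((min n (⌈(2 / ε) ^ p⌉₊ - 1) : ℕ) : ℕ∞) := by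
  have hp0 : 0 < p := one_pos.trans_le hp
  refine le_antisymm (iInf₂_le _ (min_mem_widimSet_lpBall hp0 hε hn)) (le_iInf₂ fun k hk => ?_)
  refine Nat.cast_le.2 (le_of_mem_widimSet_lpBall hp0 hε (min_le_left _ _) ?_ hk)
  -- Positivity makes the truncated subtraction genuine, so the minimum is below the ceiling and
  -- hence below `(2 / ε) ^ p`.
  have hpos : 0 < ⌈(2 / ε) ^ p⌉₊ := Nat.ceil_pos.2 (by positivity)
  exact Nat.lt_ceil.1 (by omega)
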